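/- Let $n,m\ge 0$ be integers. A \emph{partial function} $h$ on strings in $\Sigma^N$ with Boolean output is a function $h:\mathrm{Dom}(h)\to\{0,1\}$ with $\mathrm{Dom}(h)\subseteq\Sigma^N$. A deterministic query algorithm is a decision tree that adaptively queries coordinates of its input and finally outputs a bit; a randomized algorithm $A$ is a probability distribution over deterministic ones. It computes $h$ with error at most $\epsilon$ if, for every $x\in\mathrm{Dom}(h)$, it outputs $h(x)$ with probability at least $1-\epsilon$. Its expected cost for $h$ is the maximum over $x\in\mathrm{Dom}(h)$ of the expected number of queries it makes on $x$; its worst-case cost for $h$ is the maximum number of queries made on any $x\in\mathrm{Dom}(h)$ by any deterministic algorithm in its support (a maximum over the empty set is $0$). Let $\overline{\mathrm R}_\epsilon(h)$ and $\mathrm R_\epsilon(h)$ be the infimum of the expected cost and of the worst-case cost, respectively, over all randomized algorithms that compute $h$ with error at most $\epsilon$, and put $\mathrm R_0(h):=\overline{\mathrm R}_0(h)$ (the zero-error \emph{expected} complexity) and $\mathrm R(h):=\mathrm R_{1/3}(h)$. For a partial function $g$ with $\mathrm{Dom}(g)\subseteq\{0,1\}^m$, let $P_g\subseteq\{0,1,*\}^m$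 be the set of all $p$ for which there are $x,y\in\mathrm{Dom}(g)$ with $g(x)\ne g(y)$ and $x_i=y_i=p_i$ whenever $p_i\neq *$, and let $P_g^\dagger\subseteq\{0,1,\dagger\}^m$ be the same set with the symbol $\dagger$ in place of $*$. Let $g_{\mathrm{sab}}:P_g\cup P_g^\dagger\to\{0,1\}$ be the partial function on strings in $\{0,1,*,\dagger\}^m$ that is $0$ on $P_g$ and $1$ on $P_g^\dagger$, and let $\mathrm{RS}(g):=\mathrm R_0(g_{\mathrm{sab}})$ be the randomized sabotage complexity of $g$. For partial functions $f$ and $g$ with $\mathrm{Dom}(f)\subseteq\{0,1\}^n$ and $\mathrm{Dom}(g)\subseteq\{0,1\}^m$, let $f\circ g$ be the partial function on $nm$ bits given by $(f\circ g)(x_1,\dots,x_n)=f(g(x_1),\dots,g(x_n))$, with $x_i\in\{0,1\}^m$, whose domain consists of the inputs for which every $x_i\in\mathrm{Dom}(g)$ and $(g(x_1),\dots,g(x_n))\in\mathrm{Dom}(f)$. \textbf{Theorem.} For all partial functions $f$ and $g$ as above: \begin{enumerate} \item $\overline{\mathrm R}_\epsilon(f\circ g)\ \ge\ \overline{\mathrm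 R}_\epsilon(f)\,\mathrm{RS}(g)$ for every real $\epsilon\ge 0$; \item $\mathrm R_0(f\circ g)\ \ge\ \mathrm R_0(f)\,\mathrm{RS}(g)$; \item $\mathrm R(f\circ g)\ \ge\ \mathrm R(f)\,\mathrm{RS}(g)/10$. \end{enumerate} -/

import Mathlib

open scoped ENNReal

namespace QueryComplexity

/-- A deterministic query algorithm (decision tree) reading an input `x : ι → α` and producing
an output in `β`: it either stops with an output, or queries a coordinate `i` and continues
depending on the symbol `x i` received. -/
inductive DecisionTree (ι α β : Type) : Type
  | leaf (b : β) : DecisionTree ι α β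
  | query (i : ι) (next : α → DecisionTree ι α β) : DecisionTree ι α β

namespace DecisionTree

variable {ι α β : Type}

/-- The output of the algorithm on input `x`. -/
def output : DecisionTree ι α β → (ι → α) → β
  | leaf b, _ => b
  | query i next, x => (next (x i)).output x

/-- The number of queries that the algorithm makes on input `x`. -/
def cost : DecisionTree ι α β → (ι → α) → ℕ
  | leaf _, _ => 0
  | query i next, x => (next (x i)).cost x + 1

end DecisionTree

/-- A randomized query algorithm: a probability distribution over deterministic ones. -/
abbrev RandomizedAlgorithm (ι α β : Type) : Type := PMF (DecisionTree ι α β)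

namespace RandomizedAlgorithm

variable {ι α β : Type}

/-- `A` computes the partial function `f` with error at most `ε`: on every input `x` in the domain
of `f`, it outputs `f x` with probability at least `1 - ε`. -/
def Computes (A : RandomizedAlgorithm ι α β) (f : (ι → α) →. β) (ε : ℝ) : Prop :=
  ∀ x ∈ f.Dom, ENNReal.ofReal (1 - ε) ≤ A.toOuterMeasure {D | D.output x ∈ f x}

/-- The expected number of queries that `A` makes on input `x`. -/
noncomputable def expectedQueries (A : RandomizedAlgorithm ι α β) (x : ι → α) : ℝ≥0∞ :=
  ∑' D, A D * (D.cost x : ℝ≥0∞)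

/-- The expected cost of `A` as an algorithm for `f`: its expected number of queries, maximized
over the inputs of `f`. -/
noncomputable def expectedCost (A : RandomizedAlgorithm ι α β) (f : (ι → α) →. β) : ℝ≥0∞ :=
  ⨆ x ∈ f.Dom, A.expectedQueries x

/-- The worst-case cost of `A` as an algorithm for `f`: the largest number of queries made on an
input of `f` by a deterministic algorithm in the support of `A`. -/
noncomputable def worstCaseCost (A : RandomizedAlgorithm ι α β) (f : (ι → α) →. β) : ℝ≥0∞ :=
  ⨆ D ∈ A.support, ⨆ x ∈ f.Dom, (D.cost x : ℝ≥0∞)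

end RandomizedAlgorithm

section Measures

variable {ι α β : Type}

/-- The `ε`-error expected randomized query complexity of a partial function. -/
noncomputable def Rbar (ε : ℝ) (f : (ι → α) →. β) : ℝ≥0∞ :=
  ⨅ (A : RandomizedAlgorithm ι α β) (_ : A.Computes f ε), A.expectedCost f

/-- The `ε`-error worst-case randomized query complexity of a partial function. -/
noncomputable def Rerr (ε : ℝ) (f : (ι → α) →. β) : ℝ≥0∞ :=
  ⨅ (A : RandomizedAlgorithm ι α β) (_ : A.Computes f ε), A.worstCaseCost f

/-- Bounded-error randomized query complexity: worst-case cost, error `1/3`. -/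
noncomputable def R (f : (ι → α) →. β) : ℝ≥0∞ := Rerr (1 / 3) f

/-- Zero-error expected randomized query complexity. -/
noncomputable def R0 (f : (ι → α) →. β) : ℝ≥0∞ := Rbar 0 f

end Measures

/-- The alphabet `{0, 1, *, †}` of sabotaged inputs. -/
inductive SabSymbol : Type
  | bit (b : Bool) : SabSymbol
  | star : SabSymbol
  | dagger : SabSymbol

section Sabotage

variable {ι : Type}

/-- The strings over `{0, 1, s}` that are consistent, away from the positions holding the special
symbol `s`, with two inputs `x`, `y` of `f` on which `f` takes different values. For `s = *` this
is the set `P_f`, for `s = †` the set `P_f^†`. -/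
def sabotagedInputs (s : SabSymbol) (f : (ι → Bool) →. Bool) : Set (ι → SabSymbol) :=
  {p | ∃ x y : ι → Bool, (∃ a ∈ f x, ∃ b ∈ f y, a ≠ b) ∧
    ∀ i, p i = s ∨ (p i = .bit (x i) ∧ p i = .bit (y i))}

open Classical in
/-- The sabotage problem `f_sab`: given the promise that the input lies in `P_f ∪ P_f^†`, output
`0` if it lies in `P_f` and `1` if it lies in `P_f^†` (the two sets are disjoint). -/
noncomputable def sab (f : (ι → Bool) →. Bool) : (ι → SabSymbol) →. Bool := fun q =>
  ⟨q ∈ sabotagedInputs .star f ∪ sabotagedInputs .dagger f,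
    fun _ => decide (q ∈ sabotagedInputs .dagger f)⟩

/-- Randomized sabotage complexity. -/
noncomputable def RS (f : (ι → Bool) →. Bool) : ℝ≥0∞ := R0 (sab f)

end Sabotage

/-- The composition `f ∘ g` of partial Boolean functions: an input consists of one block `x i`
for each input bit `i` of `f`, and `(f ∘ g) x = f (i ↦ g (x i))`, which is defined if and only if
all `g (x i)` are defined and the string that they form is in the domain of `f`. The bits of `x`
are indexed by pairs (block, position within the block). -/
def compose {ι κ : Type} (f : (ι → Bool) →. Bool) (g : (κ → Bool) →. Bool) :
    (ι × κ → Bool) →. Bool := fun x =>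
  Part.assert (∀ i, (g fun j => x (i, j)).Dom) fun h =>
    f fun i => (g fun j => x (i, j)).get (h i)

end QueryComplexity

open QueryComplexity

/-!
The first inequality is a reduction. By linear duality (`exists_weights_nonneg`) there is, for every
`c < RS g`, one distribution on pairs of inputs of `g` with values `0` and `1` such that every
decision tree makes at least `c` times as many queries, in expectation, as its probability of
reading a position where the two members differ (`exists_hard_distribution`): were there a mixture
of trees that does better on every pair, then running it before an almost optimal zero-error
algorithm for the sabotage problem would bring the cost below the optimum. Given an algorithm for
`f ∘ g`, an algorithm for `f` on input `z` draws such a pair for every block and runs the given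
algorithm on the blocks selected by `z` (`simulate`). A bit of `z` is queried only when the run
reads a position where the two candidates for its block differ. Restricted to one block, with the
other blocks fixed, the run is a decision tree on that block (`blockTree`), so each query to `z` is
paid for by at least `c` queries to the block. The second inequality is the case `ε = 0`.

The third one needs, besides the first, that `Rerr (1 / 3) f ≤ 10 * Rbar (1 / 3) f`
(`Rerr_third_le`). Five runs of an algorithm of expected cost `T` share a budget drawn uniformly
from `{0, …, ⌊10 T⌋}`, and the majority among the completed runs is output. With a uniform budget,
the probability that a run with `t` queries is the one to exhaust it is at most `t / (10 T)`,
independently of earlier runs, so that the error caused by exhaustion is bounded by a sum over the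
five runs (`sum_voteError_le`). The correlation between the cost and the output of a run is
arbitrary, and the bound allows for the worst case. Together with the error of a majority of five it
is a polynomial in the error probability of a single run that is at most `1 / 3` on `[0, 1 / 3]`.
-/

open scoped ENNReal NNReal

namespace QueryComplexity

open DecisionTree

/-! ### Expectations with respect to a probability mass function -/

section Mean

variable {α β : Type*}

/-- The expectation of a `[0, ∞]`-valued function. -/
noncomputable def mean (p : PMF α) (φ : α → ℝ≥0∞) : ℝ≥0∞ := ∑' a, p a * φ a

theorem mean_mono (p : PMF α) {φ ψ : α → ℝ≥0∞} (h : ∀ a, φ a ≤ ψ a) : mean p φ ≤ mean p ψ :=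
  ENNReal.tsum_le_tsum fun a => mul_le_mul_right (h a) _

theorem mean_add (p : PMF α) (φ ψ : α → ℝ≥0∞) :
    mean p (fun a => φ a + ψ a) = mean p φ + mean p ψ := by
  simp only [mean, mul_add, ENNReal.tsum_add]

theorem mean_const_mul (p : PMF α) (c : ℝ≥0∞) (φ : α → ℝ≥0∞) :
    mean p (fun a => c * φ a) = c * mean p φ := by
  simp only [mean, ← ENNReal.tsum_mul_left]
  exact tsum_congr fun a => by ring

theorem mean_mul_const (p : PMF α) (c : ℝ≥0∞) (φ : α → ℝ≥0∞) :
    mean p (fun a => φ a * c) = mean p φ * c := by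
  simp only [mul_comm _ c, mean_const_mul]

theorem mean_const (p : PMF α) (c : ℝ≥0∞) : mean p (fun _ => c) = c := by
  simp [mean, ENNReal.tsum_mul_right, p.tsum_coe]

theorem mean_sum (p : PMF α) {ι : Type*} (s : Finset ι) (φ : ι → α → ℝ≥0∞) :
    mean p (fun a => ∑ i ∈ s, φ i a) = ∑ i ∈ s, mean p (φ i) := by
  simp only [mean, Finset.mul_sum]
  exact Summable.tsum_finsetSum fun _ _ => ENNReal.summable

theorem mean_eq_sum [Fintype α] (p : PMF α) (φ : α → ℝ≥0∞) : mean p φ = ∑ a, p a * φ a :=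
  tsum_fintype _

theorem mean_pure (a : α) (φ : α → ℝ≥0∞) : mean (PMF.pure a) φ = φ a := by
  rw [mean, tsum_eq_single a]
  · simp
  · intro b hb
    simp [PMF.pure_apply, hb]

theorem mean_bind (p : PMF α) (q : α → PMF β) (φ : β → ℝ≥0∞) :
    mean (p.bind q) φ = mean p fun a => mean (q a) φ := by
  simp only [mean, PMF.bind_apply, ← ENNReal.tsum_mul_right, ← ENNReal.tsum_mul_left]
  rw [ENNReal.tsum_comm]
  exact tsum_congr fun a => tsum_congr fun b => by ring

theorem mean_comm (p : PMF α) (q : PMF β) (φ : α → β → ℝ≥0∞) :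
    mean p (fun a => mean q (φ a)) = mean q fun b => mean p fun a => φ a b := by
  simp only [mean, ← ENNReal.tsum_mul_left]
  rw [ENNReal.tsum_comm]
  exact tsum_congr fun a => tsum_congr fun b => by ring

open Classical in
theorem toOuterMeasure_eq_mean (p : PMF α) (s : Set α) :
    p.toOuterMeasure s = mean p fun a => if a ∈ s then 1 else 0 := by
  rw [PMF.toOuterMeasure_apply, mean]
  exact tsum_congr fun a => by by_cases h : a ∈ s <;> simp [h]

theorem mean_le_of_support (p : PMF α) (φ : α → ℝ≥0∞) (c : ℝ≥0∞)
    (h : ∀ a ∈ p.support, φ a ≤ c) : mean p φ ≤ c := by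
  refine le_trans (ENNReal.tsum_le_tsum (g := fun a => p a * c) fun a => ?_) (mean_const p c).le
  by_cases ha : p a = 0
  · simp [ha]
  · exact mul_le_mul_right (h a ((PMF.mem_support_iff p a).2 ha)) _

end Mean

theorem Rbar_le_Rerr {ι α β : Type} (ε : ℝ) (f : (ι → α) →. β) : Rbar ε f ≤ Rerr ε f := by
  refine iInf₂_mono fun A _ => iSup₂_le fun x hx => mean_le_of_support A _ _ fun D hD => ?_
  exact le_trans (le_iSup₂ (f := fun y (_ : y ∈ f.Dom) => (D.cost y : ℝ≥0∞)) x hx)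
    (le_iSup₂ (f := fun E (_ : E ∈ A.support) => ⨆ y ∈ f.Dom, (DecisionTree.cost E y : ℝ≥0∞)) D hD)

/-! ### Repeated runs under a common query budget -/

namespace DecisionTree

variable {ι α β γ : Type}

/-- Run a tree with a budget of `i` queries. If it stops within the budget, `next` continues from
its output and the remaining budget; otherwise, continue with `d` instead of making query number
`i + 1`. -/
def runWithin (d : DecisionTree ι α γ) (next : β → ℕ → DecisionTree ι α γ) :
    DecisionTree ι α β → ℕ → DecisionTree ι α γ
  | leaf b, i => next b i
  | query _ _, 0 => d
  | query j nx, i + 1 => query j fun a => runWithin d next (nx a) i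

theorem output_runWithin (d : DecisionTree ι α γ) (next : β → ℕ → DecisionTree ι α γ)
    (D : DecisionTree ι α β) (i : ℕ) (x : ι → α) :
    (runWithin d next D i).output x =
      if D.cost x ≤ i then (next (D.output x) (i - D.cost x)).output x else d.output x := by
  induction D generalizing i with
  | leaf b => simp [runWithin, cost, output]
  | query j nx ih =>
    cases i with
    | zero => simp [runWithin, cost]
    | succ i => simp [runWithin, cost, output, ih]

theorem cost_runWithin_le {d : DecisionTree ι α γ} {next : β → ℕ → DecisionTree ι α γ}
    {x : ι → α} (hd : d.cost x = 0) (hnext : ∀ b k, (next b k).cost x ≤ k)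
    (D : DecisionTree ι α β) (i : ℕ) : (runWithin d next D i).cost x ≤ i := by
  induction D generalizing i with
  | leaf b => exact hnext b i
  | query j nx ih =>
    cases i with
    | zero => simp [runWithin, hd]
    | succ i => simpa [runWithin, cost] using ih (x j) i

/-- The winner of a vote in which `true` is ahead by `v` votes. -/
def winner (tie : Bool) (v : ℤ) : Bool := if 0 < v then true else if v < 0 then false else tie

/-- Run the trees of a list in turn under a common budget of `i` queries, starting with `true` ahead
by `v` votes, and output the winner of the vote among the runs completed within the budget. -/
def voteTree (tie : Bool) : List (DecisionTree ι α Bool) → ℤ → ℕ → DecisionTree ι α Bool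
  | [], v, _ => leaf (winner tie v)
  | D :: l, v, i => runWithin (leaf (winner tie v))
      (fun b k => voteTree tie l (v + if b then 1 else -1) k) D i

theorem cost_voteTree_le (tie : Bool) (l : List (DecisionTree ι α Bool)) (v : ℤ) (i : ℕ)
    (x : ι → α) : (voteTree tie l v i).cost x ≤ i := by
  induction l generalizing v i with
  | nil => simp [voteTree, cost]
  | cons D l ih => exact cost_runWithin_le rfl (fun b k => ih _ k) D i

end DecisionTree

/-- The probability that a vote is lost if it is closed at margin `m` in favour of the correct
answer, a tie being broken by a fair coin. -/
noncomputable def lossAt (m : ℤ) : ℝ≥0 := if 0 < m then 0 else if m < 0 then 1 else 1 / 2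

/-- The probability of losing the vote from margin `m` when `s` more independent votes are cast,
each of them correct with probability `q` and wrong with probability `p`. -/
noncomputable def lossProb (p q : ℝ≥0) : ℕ → ℤ → ℝ≥0
  | 0, m => lossAt m
  | s + 1, m => q * lossProb p q s (m + 1) + p * lossProb p q s (m - 1)

/-- The probability of winning the vote, in the situation of `lossProb`. -/
noncomputable def winProb (p q : ℝ≥0) : ℕ → ℤ → ℝ≥0
  | 0, m => 1 - lossAt m
  | s + 1, m => q * winProb p q s (m + 1) + p * winProb p q s (m - 1)

/-- A bound for the additional loss from closing the vote early, per unit of the probability with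
which a single run exhausts the budget. A budget exhausted by the next run matters only if the vote
would be lost now but won at the end. -/
noncomputable def earlyLoss (p q : ℝ≥0) : ℕ → ℤ → ℝ≥0
  | 0, _ => 0
  | s + 1, m => q * earlyLoss p q s (m + 1) + p * earlyLoss p q s (m - 1) +
      lossAt m * winProb p q s (m + 1)

theorem lossAt_le_one (m : ℤ) : lossAt m ≤ 1 := by
  unfold lossAt
  split_ifs
  · simp
  · simp
  · exact half_le_self zero_le_one

theorem lossAt_anti {m m' : ℤ} (h : m ≤ m') : lossAt m' ≤ lossAt m := by
  unfold lossAt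
  split_ifs <;> first | omega | simp

theorem lossProb_add_winProb {p q : ℝ≥0} (h : p + q = 1) (s : ℕ) (m : ℤ) :
    lossProb p q s m + winProb p q s m = 1 := by
  induction s generalizing m with
  | zero => exact add_tsub_cancel_of_le (lossAt_le_one m)
  | succ s ih =>
    simp only [lossProb, winProb]
    calc _ = q * (lossProb p q s (m + 1) + winProb p q s (m + 1)) +
        p * (lossProb p q s (m - 1) + winProb p q s (m - 1)) := by ring
      _ = 1 := by rw [ih, ih, mul_one, mul_one, add_comm, h]

theorem winProb_mono (p q : ℝ≥0) (s : ℕ) : Monotone (winProb p q s) := by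
  induction s with
  | zero => exact fun m m' h => tsub_le_tsub_left (lossAt_anti h) 1
  | succ s ih =>
    intro m m' h
    simp only [winProb]
    gcongr
    · exact ih (by omega)
    · exact ih (by omega)

/-- With five votes the bound is tight at `p = 1 / 3`. With three votes it would exceed `1 / 3`
there. -/
theorem lossProb_five_add_earlyLoss_le {p q : ℝ≥0} (h : p + q = 1) (hp : p ≤ 1 / 3) :
    lossProb p q 5 0 + earlyLoss p q 5 0 / 10 ≤ 1 / 3 := by
  obtain ⟨P, hP⟩ : ∃ P : ℝ, (p : ℝ) = P := ⟨_, rfl⟩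
  have hq : (q : ℝ) = 1 - P := by
    have : (p : ℝ) + q = 1 := by exact_mod_cast h
    linarith
  have h0 : 0 ≤ P := hP ▸ p.2
  have h1 : P ≤ 1 / 3 := by
    rw [← hP]
    exact_mod_cast hp
  rw [← NNReal.coe_le_coe]
  have half : ((1 - 1 / 2 : ℝ≥0) : ℝ) = 1 / 2 := by
    rw [NNReal.coe_sub (half_le_self zero_le_one)]
    norm_num
  have hpoly : ((lossProb p q 5 0 + earlyLoss p q 5 0 / 10 : ℝ≥0) : ℝ) = 1 / 3 -
      (1 / 3 - P) * (17 / 20 + 39 / 20 * P + 81 / 20 * P ^ 2 - 237 / 20 * P ^ 3 + 6 * P ^ 4) := by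
    norm_num [lossProb, earlyLoss, winProb, lossAt, hP, hq, half]
    ring
  rw [hpoly]
  have h3 : P ^ 3 ≤ (1 / 3) ^ 3 := pow_le_pow_left₀ h0 h1 3
  have h4 : 0 ≤ 17 / 20 + 39 / 20 * P + 81 / 20 * P ^ 2 - 237 / 20 * P ^ 3 + 6 * P ^ 4 := by
    have : 0 ≤ 39 / 20 * P + 81 / 20 * P ^ 2 + 6 * P ^ 4 := by positivity
    linarith
  have := mul_nonneg (sub_nonneg.2 h1) h4
  push_cast
  linarith

section Vote

variable {ι α : Type}

/-- The probability that the vote among `s` runs of `A` on input `x` under a budget of `i` queries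
is lost, starting from margin `m` in favour of the correct answer `b`. -/
noncomputable def voteError (A : RandomizedAlgorithm ι α Bool) (x : ι → α) (b : Bool) :
    ℕ → ℤ → ℕ → ℝ≥0∞
  | 0, m, _ => lossAt m
  | s + 1, m, i => mean A fun D =>
      if D.cost x ≤ i then voteError A x b s (m + if D.output x = b then 1 else -1) (i - D.cost x)
      else lossAt m

/-- Lists of `s` independent samples. -/
noncomputable def iidList {T : Type} (A : PMF T) : ℕ → PMF (List T)
  | 0 => PMF.pure []
  | s + 1 => A.bind fun D => (iidList A s).bind fun l => PMF.pure (D :: l)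

theorem mean_coin (φ : Bool → ℝ≥0∞) :
    mean (PMF.uniformOfFintype Bool) φ = 2⁻¹ * (φ true + φ false) := by
  simp [mean_eq_sum, mul_add]

theorem mean_winner_ne (b : Bool) (v : ℤ) :
    mean (PMF.uniformOfFintype Bool) (fun tie => if winner tie v = b then 0 else 1) =
      lossAt ((if b then 1 else -1) * v) := by
  rw [mean_coin]
  rcases lt_trichotomy v 0 with h | h | h
  · have h' : ¬ 0 < v := by omega
    cases b <;> simp [winner, lossAt, h, h', one_add_one_eq_two, ENNReal.inv_mul_cancel]
  · subst h
    cases b <;> simp [winner, lossAt]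
  · have h' : ¬ v < 0 := by omega
    cases b <;> simp [winner, lossAt, h, h', one_add_one_eq_two, ENNReal.inv_mul_cancel]

theorem mean_voteTree_ne (A : RandomizedAlgorithm ι α Bool) (x : ι → α) (b : Bool)
    (s : ℕ) (v : ℤ) (i : ℕ) :
    (mean (PMF.uniformOfFintype Bool) fun tie => mean (iidList A s) fun l =>
      if (voteTree tie l v i).output x = b then 0 else 1) =
      voteError A x b s ((if b then 1 else -1) * v) i := by
  induction s generalizing v i with
  | zero =>
    simp only [iidList, mean_pure, voteTree, output, voteError]
    exact mean_winner_ne b v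
  | succ s ih =>
    simp only [iidList, mean_bind, mean_pure, voteError]
    rw [mean_comm]
    congr 1
    funext D
    simp only [voteTree, output_runWithin]
    by_cases hD : D.cost x ≤ i
    · simp only [hD, if_true]
      rw [ih]
      congr 1
      cases b <;> cases D.output x <;> simp [add_comm]
    · simp only [hD, if_false, output, mean_const]
      exact mean_winner_ne b v

/-- A budget drawn uniformly from `{0, …, n - 1}` is exhausted by a run with `t` queries with
probability at most `t / n`, whatever has been spent before. The extra loss is therefore linear in
the expected number `T` of queries of a run. -/
theorem sum_voteError_le {A : RandomizedAlgorithm ι α Bool} {x : ι → α} {b : Bool} {p q : ℝ≥0}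
    (hpq : p + q = 1) (hq : mean A (fun D => if D.output x = b then 1 else 0) = q)
    (hp : mean A (fun D => if D.output x = b then 0 else 1) = p)
    (s : ℕ) (m : ℤ) (n : ℕ) :
    ∑ i ∈ Finset.range n, voteError A x b s m i ≤
      n * lossProb p q s m + A.expectedQueries x * earlyLoss p q s m := by
  induction s generalizing m n with
  | zero => simp [voteError, lossProb, earlyLoss]
  | succ s ih =>
    simp only [voteError]
    rw [← mean_sum]
    set T := A.expectedQueries x with hT
    -- the potential after a run that contributes `e` to the margin
    set pot : ℤ → ℝ≥0∞ := fun e =>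
      n * lossProb p q s (m + e) + T * earlyLoss p q s (m + e) with hpot
    have key : ∀ D : DecisionTree ι α Bool, ∀ e : ℤ, e ≤ 1 →
        ∑ i ∈ Finset.range n, (if D.cost x ≤ i then voteError A x b s (m + e) (i - D.cost x)
          else (lossAt m : ℝ≥0∞)) ≤
        pot e + D.cost x * (lossAt m * winProb p q s (m + 1) : ℝ≥0) := by
      intro D e he
      have hloss : (lossAt m : ℝ≥0∞) ≤
          lossProb p q s (m + e) + (lossAt m * winProb p q s (m + 1) : ℝ≥0) := by
        rw [← ENNReal.coe_add, ENNReal.coe_le_coe]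
        calc lossAt m = lossAt m * lossProb p q s (m + e) + lossAt m * winProb p q s (m + e) := by
              rw [← mul_add, lossProb_add_winProb hpq, mul_one]
          _ ≤ _ := by
              gcongr
              · exact mul_le_of_le_one_left zero_le (lossAt_le_one m)
              · exact winProb_mono p q s (by omega)
      set w : ℝ≥0∞ := ((lossAt m * winProb p q s (m + 1) : ℝ≥0) : ℝ≥0∞)
      set t := D.cost x
      rcases le_total t n with htn | hnt
      · obtain ⟨k, rfl⟩ := Nat.exists_eq_add_of_le htn
        rw [Finset.sum_range_add]
        have h1 : ∑ i ∈ Finset.range t, (if t ≤ i then voteError A x b s (m + e) (i - t)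
            else (lossAt m : ℝ≥0∞)) = t * lossAt m := by
          rw [Finset.sum_congr rfl (g := fun _ => (lossAt m : ℝ≥0∞))]
          · simp
          · intro i hi
            rw [if_neg (by simpa using hi)]
        have h2 : ∑ i ∈ Finset.range k, (if t ≤ t + i then voteError A x b s (m + e) (t + i - t)
            else (lossAt m : ℝ≥0∞)) = ∑ i ∈ Finset.range k, voteError A x b s (m + e) i := by
          refine Finset.sum_congr rfl fun i _ => ?_
          rw [if_pos (Nat.le_add_right _ _), Nat.add_sub_cancel_left]
        rw [h1, h2]
        calc _ ≤ t * (lossProb p q s (m + e) + w) + (k * lossProb p q s (m + e) +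
              T * earlyLoss p q s (m + e)) := by gcongr; exact ih _ _
          _ = _ := by simp only [hpot]; push_cast; ring
      · have h1 : ∑ i ∈ Finset.range n, (if t ≤ i then voteError A x b s (m + e) (i - t)
            else (lossAt m : ℝ≥0∞)) = n * lossAt m := by
          rw [Finset.sum_congr rfl (g := fun _ => (lossAt m : ℝ≥0∞))]
          · simp
          · intro i hi
            rw [if_neg (by have := Finset.mem_range.1 hi; omega)]
        rw [h1]
        calc _ ≤ n * (lossProb p q s (m + e) + w) := by gcongr
          _ = n * lossProb p q s (m + e) + n * w := mul_add _ _ _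
          _ ≤ pot e + t * w := by
            gcongr
            exact le_self_add
    calc _ ≤ mean A fun D => ((if D.output x = b then 1 else 0) * pot 1 +
          (if D.output x = b then 0 else 1) * pot (-1)) +
          D.cost x * (lossAt m * winProb p q s (m + 1) : ℝ≥0) := by
          refine mean_mono A fun D => ?_
          by_cases hD : D.output x = b
          · simpa [hD] using key D 1 le_rfl
          · simpa [hD] using key D (-1) (by norm_num)
      _ = q * pot 1 + p * pot (-1) + T * (lossAt m * winProb p q s (m + 1) : ℝ≥0) := by
          rw [mean_add, mean_add, mean_mul_const, mean_mul_const, mean_mul_const, hq, hp]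
          rfl
      _ = _ := by
          simp only [hpot, lossProb, earlyLoss, ← sub_eq_add_neg]
          push_cast
          ring

end Vote

/-- The passage from expected to worst-case cost without increasing the error: the majority of five
runs, under a common budget that is drawn uniformly from `{0, …, ⌊10 T⌋}` for an algorithm of
expected cost `T`. -/
theorem Rerr_third_le {ι α : Type} (f : (ι → α) →. Bool) :
    Rerr (1 / 3) f ≤ 10 * Rbar (1 / 3) f := by
  rw [Rbar, ENNReal.mul_iInf_of_ne (by norm_num) (by norm_num)]
  refine le_iInf fun A => ?_
  by_cases hA : A.Computes f (1 / 3)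
  swap
  · rw [iInf_neg hA, ENNReal.mul_top (by norm_num)]
    exact le_top
  simp only [hA, iInf_pos]
  set T := A.expectedCost f with hT
  rcases eq_or_ne T ⊤ with htop | htop
  · rw [htop, ENNReal.mul_top (by norm_num)]
    exact le_top
  obtain ⟨τ, hτ⟩ : ∃ τ : ℝ≥0, T = τ := ⟨T.toNNReal, (ENNReal.coe_toNNReal htop).symm⟩
  set N := ⌊10 * τ⌋₊ with hN
  let B : RandomizedAlgorithm ι α Bool :=
    (PMF.uniformOfFintype (Fin (N + 1))).bind fun i => (PMF.uniformOfFintype Bool).bind fun tie =>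
      (iidList A 5).bind fun l => PMF.pure (voteTree tie l 0 i)
  have hB : B.Computes f (1 / 3) := by
    intro x hx
    obtain ⟨b, hb⟩ := Part.dom_iff_mem.1 hx
    have hmem : ∀ c : Bool, c ∈ f x ↔ c = b := fun c =>
      ⟨fun hc => Part.mem_unique hc hb, fun hc => hc ▸ hb⟩
    have hsum : ∀ C : RandomizedAlgorithm ι α Bool,
        mean C (fun D => if D.output x = b then 0 else 1) +
          mean C (fun D => if D.output x = b then 1 else 0) = 1 := by
      intro C
      rw [← mean_add]
      refine Eq.trans ?_ (mean_const C 1)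
      congr 1
      funext D
      split_ifs <;> simp
    have hAx := hA x hx
    rw [toOuterMeasure_eq_mean] at hAx ⊢
    simp only [Set.mem_ofPred_eq, hmem] at hAx ⊢
    obtain ⟨p, hp⟩ : ∃ p : ℝ≥0, mean A (fun D => if D.output x = b then 0 else 1) = p :=
      ⟨_, (ENNReal.coe_toNNReal (ne_top_of_le_ne_top ENNReal.one_ne_top
        (le_self_add.trans (hsum A).le))).symm⟩
    obtain ⟨q, hq⟩ : ∃ q : ℝ≥0, mean A (fun D => if D.output x = b then 1 else 0) = q :=
      ⟨_, (ENNReal.coe_toNNReal (ne_top_of_le_ne_top ENNReal.one_ne_top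
        (le_add_self.trans (hsum A).le))).symm⟩
    have hpq : p + q = 1 := by
      have := hsum A
      rw [hp, hq] at this
      exact_mod_cast this
    have hp3 : p ≤ 1 / 3 := by
      rw [hq] at hAx
      have h1 : (1 - 1 / 3 : ℝ) ≤ q := by
        rw [ENNReal.ofReal_le_iff_le_toReal ENNReal.coe_ne_top] at hAx
        simpa using hAx
      have h2 : (p : ℝ) + q = 1 := by exact_mod_cast hpq
      rw [← NNReal.coe_le_coe]
      push_cast
      linarith
    have herr : mean B (fun D => if D.output x = b then 0 else 1) ≤ (1 / 3 : ℝ≥0) := by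
      have h1 : mean B (fun D => if D.output x = b then 0 else 1) =
          (N + 1 : ℝ≥0∞)⁻¹ * ∑ i ∈ Finset.range (N + 1), voteError A x b 5 0 i := by
        simp only [B, mean_bind, mean_pure, mean_voteTree_ne, mul_zero]
        rw [mean_eq_sum, Finset.mul_sum, Finset.sum_range]
        simp
      have h2 : (N + 1 : ℝ≥0∞)⁻¹ * τ ≤ (10⁻¹ : ℝ≥0) := by
        have h3 : 10 * τ ≤ N + 1 := (Nat.lt_floor_add_one (10 * τ)).le
        have h4 : ((N : ℝ≥0) + 1)⁻¹ * τ ≤ 10⁻¹ := by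
          rw [inv_mul_le_iff₀ (by positivity), le_mul_inv_iff₀ (by norm_num), mul_comm]
          exact h3
        have h5 : ((((N : ℝ≥0) + 1)⁻¹ * τ : ℝ≥0) : ℝ≥0∞) = (N + 1 : ℝ≥0∞)⁻¹ * τ := by
          rw [ENNReal.coe_mul, ENNReal.coe_inv (by positivity)]
          push_cast
          rfl
        rw [← h5]
        exact_mod_cast h4
      have hTx : A.expectedQueries x ≤ τ := by
        rw [← hτ]
        exact le_iSup₂ (f := fun y (_ : y ∈ f.Dom) => A.expectedQueries y) x hx
      rw [h1]
      calc _ ≤ (N + 1 : ℝ≥0∞)⁻¹ * ((N + 1 : ℕ) * lossProb p q 5 0 +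
            A.expectedQueries x * earlyLoss p q 5 0) := by
            gcongr
            exact sum_voteError_le hpq hq hp 5 0 (N + 1)
        _ ≤ (N + 1 : ℝ≥0∞)⁻¹ * ((N + 1 : ℕ) * lossProb p q 5 0 + τ * earlyLoss p q 5 0) := by
            gcongr
        _ = (N + 1 : ℝ≥0∞)⁻¹ * (N + 1) * lossProb p q 5 0 +
            (N + 1 : ℝ≥0∞)⁻¹ * τ * earlyLoss p q 5 0 := by push_cast; ring
        _ ≤ 1 * lossProb p q 5 0 + (10⁻¹ : ℝ≥0) * earlyLoss p q 5 0 := by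
            gcongr
            exact ENNReal.inv_mul_le_one _
        _ ≤ (1 / 3 : ℝ≥0) := by
            rw [one_mul, ← ENNReal.coe_mul, ← ENNReal.coe_add, ENNReal.coe_le_coe,
              mul_comm, ← div_eq_mul_inv]
            exact lossProb_five_add_earlyLoss_le hpq hp3
    have h1 := hsum B
    have h2 : (1 : ℝ≥0∞) ≤ (1 / 3 : ℝ≥0) + mean B (fun D => if D.output x = b then 1 else 0) := by
      exact h1.symm.le.trans (add_le_add_left herr _)
    have h3 : ENNReal.ofReal (1 - 1 / 3) = 1 - (1 / 3 : ℝ≥0) := by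
      rw [ENNReal.ofReal_sub _ (by norm_num), ENNReal.ofReal_one]
      congr 1
      rw [← ENNReal.ofReal_coe_nnreal]
      norm_num
    rw [h3]
    exact tsub_le_iff_left.2 h2
  refine (iInf₂_le B hB).trans (iSup₂_le fun D hD => iSup₂_le fun x _ => ?_)
  simp only [B, PMF.mem_support_bind_iff, PMF.mem_support_pure_iff] at hD
  obtain ⟨i, -, tie, -, l, -, rfl⟩ := hD
  have h1 : (voteTree tie l 0 i).cost x ≤ N :=
    (cost_voteTree_le tie l 0 i x).trans (Nat.lt_succ_iff.1 i.2)
  have h2 : (N : ℝ≥0) ≤ 10 * τ := Nat.floor_le zero_le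
  rw [hτ]
  calc ((voteTree tie l 0 i).cost x : ℝ≥0∞) ≤ N := by exact_mod_cast h1
    _ ≤ 10 * τ := by exact_mod_cast h2

/-! ### Separating two inputs -/

namespace DecisionTree

variable {κ β : Type}

/-- Whether a tree, run on `x`, reads a position where `x` and `y` differ (`1` if it does, `0`
otherwise). -/
def sep : DecisionTree κ Bool β → (κ → Bool) → (κ → Bool) → ℕ
  | leaf _, _, _ => 0
  | query j nx, x, y => if x j = y j then sep (nx (x j)) x y else 1

/-- The number of queries of a tree, run on `x`, up to and including the first one to a position
where `x` and `y` differ. -/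
def sepCost : DecisionTree κ Bool β → (κ → Bool) → (κ → Bool) → ℕ
  | leaf _, _, _ => 0
  | query j nx, x, y => (if x j = y j then sepCost (nx (x j)) x y else 0) + 1

theorem sep_le_one (D : DecisionTree κ Bool β) (x y : κ → Bool) : sep D x y ≤ 1 := by
  induction D with
  | leaf b => simp [sep]
  | query j nx ih =>
    rw [sep]
    split_ifs
    · exact ih _
    · exact le_rfl

/-- Run a tree on a sabotaged input until it meets one of the symbols `*` and `†`, and then report
which one; if none is met, run `B`. -/
def sabotageRun (B : DecisionTree κ SabSymbol Bool) :
    DecisionTree κ Bool β → DecisionTree κ SabSymbol Bool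
  | leaf _ => B
  | query j nx => query j fun a =>
      match a with
      | .bit b => sabotageRun B (nx b)
      | .star => leaf false
      | .dagger => leaf true

/-- The tree that queries the positions in a list, whatever the answers are. -/
def readAll : List κ → DecisionTree κ Bool Bool
  | [] => leaf false
  | j :: l => query j fun _ => readAll l

theorem sepCost_readAll_le (l : List κ) (x y : κ → Bool) : sepCost (readAll l) x y ≤ l.length := by
  induction l with
  | nil => simp [readAll, sepCost]
  | cons j l ih =>
    simp only [readAll, sepCost, List.length_cons]
    split_ifs <;> omega

theorem sep_readAll {l : List κ} {x y : κ → Bool} {j : κ} (hj : j ∈ l) (h : x j ≠ y j) :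
    sep (readAll l) x y = 1 := by
  induction l with
  | nil => simp at hj
  | cons k l ih =>
    simp only [readAll, sep]
    split_ifs with hk
    · rcases List.mem_cons.1 hj with rfl | hj
      · exact absurd hk h
      · exact ih hj
    · rfl

end DecisionTree

/-- The special symbol that marks the inputs of a sabotage problem with answer `a`. -/
def sabMark (a : Bool) : SabSymbol := if a then .dagger else .star

variable {κ : Type}

theorem output_sabotageRun {β : Type} {B : DecisionTree κ SabSymbol Bool} {a : Bool}
    {q : κ → SabSymbol} {x y : κ → Bool}
    (hq : ∀ i, q i = sabMark a ∨ (q i = .bit (x i) ∧ q i = .bit (y i))) (D : DecisionTree κ Bool β) :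
    (sabotageRun B D).output q = a ∨
      (sep D x y = 0 ∧ (sabotageRun B D).output q = B.output q) := by
  induction D with
  | leaf b => simp [sabotageRun, sep]
  | query j nx ih =>
    rcases hq j with h | ⟨h, h'⟩
    · left
      cases a <;> simp [sabotageRun, output, h, sabMark]
    · have hxy : x j = y j := by simpa [h] using h'
      simpa [sabotageRun, output, sep, h, hxy] using ih (y j)

theorem cost_sabotageRun_le {β : Type} {B : DecisionTree κ SabSymbol Bool} {a : Bool}
    {q : κ → SabSymbol} {x y : κ → Bool}
    (hq : ∀ i, q i = sabMark a ∨ (q i = .bit (x i) ∧ q i = .bit (y i))) (D : DecisionTree κ Bool β) :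
    (sabotageRun B D).cost q ≤ sepCost D x y + (1 - sep D x y) * B.cost q := by
  induction D with
  | leaf b => simp [sabotageRun, sep, sepCost]
  | query j nx ih =>
    rcases hq j with h | ⟨h, h'⟩
    · have : (sabotageRun B (query j nx)).cost q = 1 := by
        cases a <;> simp [sabotageRun, cost, h, sabMark]
      rw [this, sepCost]
      omega
    · have hxy : x j = y j := by simpa [h] using h'
      have := ih (y j)
      simp only [sabotageRun, cost, sep, sepCost, h, hxy, if_true]
      omega

/-- The pairs of an input with value `0` and an input with value `1`. -/
abbrev OppositeInputs (g : (κ → Bool) →. Bool) : Type :=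
  {xy : (κ → Bool) × (κ → Bool) // false ∈ g xy.1 ∧ true ∈ g xy.2}

theorem exists_oppositeInputs {g : (κ → Bool) →. Bool} {s : SabSymbol} {q : κ → SabSymbol}
    (hq : q ∈ sabotagedInputs s g) : ∃ p : OppositeInputs g,
      ∀ i, q i = s ∨ (q i = .bit (p.1.1 i) ∧ q i = .bit (p.1.2 i)) := by
  obtain ⟨x, y, ⟨a, ha, b, hb, hab⟩, h⟩ := hq
  cases a
  · cases b
    · exact absurd rfl hab
    · exact ⟨⟨(x, y), ha, hb⟩, h⟩
  · cases b
    · exact ⟨⟨(y, x), hb, ha⟩, fun i => (h i).imp_right And.symm⟩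
    · exact absurd rfl hab

theorem OppositeInputs.exists_ne {g : (κ → Bool) →. Bool} (p : OppositeInputs g) :
    ∃ i, p.1.1 i ≠ p.1.2 i := by
  by_contra! h
  have hxy : p.1.1 = p.1.2 := funext h
  have h1 := p.2.1
  rw [hxy] at h1
  exact absurd (Part.mem_unique h1 p.2.2) (by decide)

theorem exists_of_mem_dom_sab {g : (κ → Bool) →. Bool} {q : κ → SabSymbol}
    (hq : q ∈ (sab g).Dom) : ∃ a, q ∈ sabotagedInputs (sabMark a) g := by
  rcases (show q ∈ sabotagedInputs .star g ∪ sabotagedInputs .dagger g from hq) with h | h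
  · exact ⟨false, h⟩
  · exact ⟨true, h⟩

theorem mem_sab_iff {g : (κ → Bool) →. Bool} {q : κ → SabSymbol} {a : Bool}
    (hq : q ∈ sabotagedInputs (sabMark a) g) (b : Bool) : b ∈ sab g q ↔ b = a := by
  have hdom : q ∈ sabotagedInputs .star g ∪ sabotagedInputs .dagger g := by
    cases a
    · exact Or.inl hq
    · exact Or.inr hq
  have hdec : q ∈ sabotagedInputs .dagger g ↔ a = true := by
    cases a
    · obtain ⟨p, hp⟩ := exists_oppositeInputs hq
      refine ⟨fun h => ?_, fun h => absurd h (by decide)⟩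
      obtain ⟨i, hi⟩ := p.exists_ne
      obtain ⟨p', hp'⟩ := exists_oppositeInputs h
      rcases hp i with h1 | ⟨h1, h2⟩
      · rcases hp' i with h2 | ⟨h2, -⟩ <;> simp [h1, sabMark] at h2
      · exact absurd (by simpa [h1] using h2) hi
    · simpa [sabMark] using hq
  classical
  have hmem : decide (q ∈ sabotagedInputs .dagger g) ∈ sab g q := by
    refine ⟨hdom, ?_⟩
    simp [sab]
  have hval : decide (q ∈ sabotagedInputs .dagger g) = a := by
    cases a <;> simp [hdec]
  rw [hval] at hmem
  exact ⟨fun hb => Part.mem_unique hb hmem, fun hb => hb ▸ hmem⟩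

theorem RS_eq_zero_of_isEmpty (g : (κ → Bool) →. Bool) [IsEmpty (OppositeInputs g)] :
    RS g = 0 := by
  have hdom : ∀ q, q ∉ (sab g).Dom := by
    intro q hq
    obtain ⟨a, ha⟩ := exists_of_mem_dom_sab hq
    obtain ⟨p, -⟩ := exists_oppositeInputs ha
    exact IsEmpty.false p
  rw [RS, R0, Rbar, ← nonpos_iff_eq_zero]
  refine (iInf₂_le (PMF.pure (leaf false)) fun q hq => absurd hq (hdom q)).trans ?_
  exact iSup₂_le fun q hq => absurd hq (hdom q)

theorem RS_ne_top [Fintype κ] (g : (κ → Bool) →. Bool) : RS g ≠ ⊤ := by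
  set D : DecisionTree κ Bool Bool := readAll Finset.univ.toList
  have hsep : ∀ p : OppositeInputs g, sep D p.1.1 p.1.2 = 1 := fun p => by
    obtain ⟨i, hi⟩ := p.exists_ne
    exact sep_readAll (by simp) hi
  refine ne_top_of_le_ne_top (ENNReal.natCast_ne_top (Fintype.card κ))
    ((iInf₂_le (PMF.pure (sabotageRun (leaf false) D)) fun q hq => ?_).trans
      (iSup₂_le fun q hq => ?_))
  · obtain ⟨a, ha⟩ := exists_of_mem_dom_sab hq
    obtain ⟨p, hp⟩ := exists_oppositeInputs ha
    rw [toOuterMeasure_eq_mean, mean_pure]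
    have h := output_sabotageRun (B := leaf false) hp D
    rw [hsep p] at h
    simp only [one_ne_zero, false_and, or_false] at h
    simp [mem_sab_iff ha, h]
  · obtain ⟨a, ha⟩ := exists_of_mem_dom_sab hq
    obtain ⟨p, hp⟩ := exists_oppositeInputs ha
    have h := cost_sabotageRun_le (B := leaf false) hp D
    rw [hsep p] at h
    have h2 := sepCost_readAll_le (Finset.univ.toList : List κ) p.1.1 p.1.2
    rw [Finset.length_toList, Finset.card_univ] at h2
    refine (mean_pure (sabotageRun (leaf false) D) fun D => (D.cost q : ℝ≥0∞)).le.trans ?_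
    exact_mod_cast (by simpa using h : _ ≤ sepCost D p.1.1 p.1.2).trans h2

/-! ### A hard distribution for the sabotage problem -/

/-- A minimax principle for games with finitely many pure strategies on one side: if every finite
mixture of rows has a nonnegative payoff in some column, then some mixture of columns has a
nonnegative payoff in every row. -/
theorem exists_weights_nonneg {T Q : Type} [Nonempty T] [Fintype Q] (a : T → Q → ℝ)
    (h : ∀ (J : Type) [Fintype J] (w : J → ℝ) (z : J → T), (∀ j, 0 ≤ w j) → ∑ j, w j = 1 →
      ∃ q, 0 ≤ ∑ j, w j * a (z j) q) :
    ∃ μ : Q → ℝ, (∀ q, 0 ≤ μ q) ∧ ∑ q, μ q = 1 ∧ ∀ t, 0 ≤ ∑ q, μ q * a t q := by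
  classical
  set S : Set (Q → ℝ) := Set.pi Set.univ fun _ => Set.Iio 0
  have hS : Convex ℝ S := convex_pi fun _ _ => convex_Iio 0
  have hSo : IsOpen S := isOpen_set_pi Set.finite_univ fun _ _ => isOpen_Iio
  have hdisj : Disjoint S (convexHull ℝ (Set.range a)) := by
    rw [Set.disjoint_left]
    intro v hv hv'
    obtain ⟨J, _, w, z, hw, hw1, hz, rfl⟩ := mem_convexHull_iff_exists_fintype.1 hv'
    choose t ht using hz
    obtain ⟨q, hq⟩ := h J w t hw hw1
    have := hv q (Set.mem_univ q)
    simp only [Finset.sum_apply, Pi.smul_apply, smul_eq_mul, Set.mem_Iio, ← ht] at this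
    exact absurd hq (not_le.2 this)
  obtain ⟨φ, u, hφ, hu⟩ := geometric_hahn_banach_open hS hSo (convex_convexHull ℝ _) hdisj
  have hφa : ∀ v : Q → ℝ, φ v = ∑ q, φ (Pi.single q 1) * v q := by
    intro v
    conv_lhs => rw [pi_eq_sum_univ' v]
    rw [map_sum]
    refine Finset.sum_congr rfl fun q _ => ?_
    rw [map_smul, smul_eq_mul, mul_comm]
  set ψ : ℝ := φ fun _ => -1 with hψ
  -- `u` is nonnegative, since `S` contains points arbitrarily close to the origin
  have hu0 : 0 ≤ u := by
    by_contra! hneg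
    have h1 : ∀ ε : ℝ, 0 < ε → ε * ψ < u := fun ε hε => by
      have := hφ (ε • fun _ => -1) fun q _ => by simpa using hε
      rwa [map_smul, smul_eq_mul] at this
    have h2 : ψ < 0 := by linarith [h1 1 one_pos]
    have h3 := h1 (u / 2 / ψ) (div_pos_of_neg_of_neg (by linarith) h2)
    rw [div_mul_cancel₀ _ h2.ne] at h3
    linarith
  have hψu : ψ < u := hφ _ fun q _ => by simp
  -- the functional is nonnegative on the basis vectors, since `S` is unbounded below
  have hm : ∀ q, 0 ≤ φ (Pi.single q 1) := by
    intro q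
    by_contra! hneg
    set M := (u - ψ) / -φ (Pi.single q 1)
    have hM : 0 < M := div_pos (by linarith) (by linarith)
    have h1 := hφ ((fun _ => -1) - M • Pi.single q 1) fun q' _ => by
      by_cases hq : q' = q
      · subst hq
        simpa using by linarith
      · simp [hq]
    rw [map_sub, map_smul, smul_eq_mul, ← hψ] at h1
    have h2 : M * φ (Pi.single q 1) = -(u - ψ) := by
      have : -φ (Pi.single q 1) ≠ 0 := by linarith
      rw [← neg_inj, ← mul_neg, div_mul_cancel₀ _ this, neg_neg]
    linarith
  set σ := ∑ q, φ (Pi.single q 1) with hσ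
  have hpay : ∀ t, 0 ≤ ∑ q, φ (Pi.single q 1) * a t q := fun t => by
    rw [← hφa]
    exact hu0.trans (hu _ (subset_convexHull ℝ _ ⟨t, rfl⟩))
  have hσ0 : 0 < σ := by
    refine lt_of_le_of_ne (Finset.sum_nonneg fun q _ => hm q) fun h0 => ?_
    have hz : ∀ q, φ (Pi.single q 1) = 0 := fun q =>
      (Finset.sum_eq_zero_iff_of_nonneg fun q _ => hm q).1 h0.symm q (Finset.mem_univ q)
    have h1 : ψ = 0 := by rw [hψ, hφa]; simp [hz]
    obtain ⟨t⟩ := ‹Nonempty T›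
    have h2 := hu _ (subset_convexHull ℝ _ ⟨t, rfl⟩)
    rw [hφa] at h2
    simp only [hz, zero_mul, Finset.sum_const_zero] at h2
    linarith
  refine ⟨fun q => φ (Pi.single q 1) / σ, fun q => div_nonneg (hm q) hσ0.le, ?_, fun t => ?_⟩
  · rw [← Finset.sum_div, div_self hσ0.ne']
  · simp only [div_mul_eq_mul_div, ← Finset.sum_div]
    exact div_nonneg (hpay t) hσ0.le

/-- Some distribution of opposite inputs is hard for all trees at once: the number of queries spent
is at least `c` times the probability of separating the inputs. Otherwise some mixture of trees
would separate at a lower price on every pair. Running it before an almost optimal algorithm for the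
sabotage problem would reduce the cost of the latter to less than the optimum. -/
theorem exists_hard_distribution [Fintype κ] (g : (κ → Bool) →. Bool) {c : ℝ≥0}
    (hc : c < RS g) : ∃ μ : PMF (OppositeInputs g), ∀ D : DecisionTree κ Bool Bool,
      c * mean μ (fun p => (sep D p.1.1 p.1.2 : ℝ≥0∞)) ≤
        mean μ fun p => (sepCost D p.1.1 p.1.2 : ℝ≥0∞) := by
  classical
  rcases isEmpty_or_nonempty (OppositeInputs g) with hemp | hne
  · simp [RS_eq_zero_of_isEmpty g] at hc
  have : Fintype (OppositeInputs g) := Fintype.ofFinite _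
  have : Nonempty (DecisionTree κ Bool Bool) := ⟨leaf false⟩
  obtain ⟨μ, hμ, hμ1, hμa⟩ := exists_weights_nonneg
    (fun (D : DecisionTree κ Bool Bool) (p : OppositeInputs g) =>
      (sepCost D p.1.1 p.1.2 : ℝ) - c * sep D p.1.1 p.1.2) (by
    intro J _ w z hw hw1
    by_contra! hlt
    set s : OppositeInputs g → ℝ := fun p => ∑ j, w j * sep (z j) p.1.1 p.1.2 with hs
    have hcs : ∀ p, ∑ j, w j * (sepCost (z j) p.1.1 p.1.2 : ℝ) < c * s p := fun p => by
      have := hlt p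
      simp only [mul_sub, Finset.sum_sub_distrib] at this
      rw [hs, Finset.mul_sum]
      simp only [mul_left_comm (c : ℝ)]
      linarith
    have hspos : ∀ p, 0 < s p := fun p => by
      have h1 : 0 ≤ ∑ j, w j * (sepCost (z j) p.1.1 p.1.2 : ℝ) :=
        Finset.sum_nonneg fun j _ => mul_nonneg (hw j) (Nat.cast_nonneg _)
      exact pos_of_mul_pos_right (h1.trans_lt (hcs p)) c.2
    obtain ⟨p₀, hp₀⟩ := Finite.exists_min s
    set r := (RS g).toReal
    have hr : RS g = ENNReal.ofReal r := (ENNReal.ofReal_toReal (RS_ne_top g)).symm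
    have hcr : (c : ℝ) < r := by
      rw [hr, ← ENNReal.ofReal_coe_nnreal] at hc
      exact (ENNReal.ofReal_lt_ofReal_iff_of_nonneg c.2).1 hc
    have hδ : 0 < s p₀ * (r - c) := mul_pos (hspos p₀) (sub_pos.2 hcr)
    obtain ⟨B, hB⟩ := iInf_lt_iff.1 (show Rbar 0 (sab g) < ENNReal.ofReal (r + s p₀ * (r - c)) from
      hr.trans_lt ((ENNReal.ofReal_lt_ofReal_iff_of_nonneg ENNReal.toReal_nonneg).2 (by linarith)))
    obtain ⟨hBc, hBcost⟩ := iInf_lt_iff.1 hB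
    set K := (B.expectedCost (sab g)).toReal
    have hK : B.expectedCost (sab g) = ENNReal.ofReal K :=
      (ENNReal.ofReal_toReal (ne_top_of_lt hBcost)).symm
    have hK0 : 0 ≤ K := ENNReal.toReal_nonneg
    have hKlt : K < r + s p₀ * (r - c) := by
      rw [hK] at hBcost
      exact (ENNReal.ofReal_lt_ofReal_iff_of_nonneg hK0).1 hBcost
    have hrK : r ≤ K := by
      rw [← ENNReal.ofReal_le_ofReal_iff hK0, ← hr, ← hK]
      exact iInf₂_le B hBc
    let W : PMF J := PMF.ofFintype (fun j => ENNReal.ofReal (w j)) (by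
      rw [← ENNReal.ofReal_sum_of_nonneg fun j _ => hw j, hw1, ENNReal.ofReal_one])
    let C : RandomizedAlgorithm κ SabSymbol Bool :=
      W.bind fun j => B.bind fun D => PMF.pure (sabotageRun D (z j))
    have hC : C.Computes (sab g) 0 := by
      intro q hq
      obtain ⟨a, ha⟩ := exists_of_mem_dom_sab hq
      obtain ⟨p, hp⟩ := exists_oppositeInputs ha
      have hBq := hBc q hq
      rw [toOuterMeasure_eq_mean] at hBq ⊢
      simp only [Set.mem_ofPred_eq, mem_sab_iff ha] at hBq ⊢
      simp only [C, mean_bind, mean_pure]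
      refine (hBq.trans_eq (mean_const W _).symm).trans
        (mean_mono W fun j => mean_mono B fun D => ?_)
      rcases output_sabotageRun (B := D) hp (z j) with h | ⟨-, h⟩
      · rw [if_pos h]
        split_ifs <;> simp
      · rw [h]
    have hCcost : C.expectedCost (sab g) ≤ ENNReal.ofReal (K - s p₀ * (K - c)) := by
      refine iSup₂_le fun q hq => ?_
      obtain ⟨a, ha⟩ := exists_of_mem_dom_sab hq
      obtain ⟨p, hp⟩ := exists_oppositeInputs ha
      have hBq : mean B (fun D => (D.cost q : ℝ≥0∞)) ≤ ENNReal.ofReal K := by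
        rw [← hK]
        exact le_iSup₂ (f := fun y (_ : y ∈ (sab g).Dom) => B.expectedQueries y) q hq
      have h1 : C.expectedQueries q = mean W fun j => mean B fun D =>
          ((sabotageRun D (z j)).cost q : ℝ≥0∞) := by
        change mean C _ = _
        simp only [C, mean_bind, mean_pure]
      have h2 : ∀ j, mean B (fun D => ((sabotageRun D (z j)).cost q : ℝ≥0∞)) ≤
          ENNReal.ofReal (sepCost (z j) p.1.1 p.1.2 + (1 - sep (z j) p.1.1 p.1.2) * K) := by
        intro j
        have hsep := sep_le_one (z j) p.1.1 p.1.2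
        calc _ ≤ mean B fun D => (sepCost (z j) p.1.1 p.1.2 : ℝ≥0∞) +
              ((1 - sep (z j) p.1.1 p.1.2 : ℕ) : ℝ≥0∞) * (D.cost q : ℝ≥0∞) :=
              mean_mono B fun D => by exact_mod_cast cost_sabotageRun_le (B := D) hp (z j)
          _ ≤ (sepCost (z j) p.1.1 p.1.2 : ℝ≥0∞) +
              ((1 - sep (z j) p.1.1 p.1.2 : ℕ) : ℝ≥0∞) * ENNReal.ofReal K := by
              rw [mean_add, mean_const, mean_const_mul]
              gcongr
          _ = _ := by
              rw [← ENNReal.ofReal_natCast, ← ENNReal.ofReal_natCast (1 - _),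
                ← ENNReal.ofReal_mul (Nat.cast_nonneg _), ← ENNReal.ofReal_add (by positivity)
                  (by positivity)]
              push_cast [hsep]
              rfl
      rw [h1]
      refine (mean_mono W h2).trans ?_
      rw [mean_eq_sum]
      simp only [W, PMF.ofFintype_apply, ← ENNReal.ofReal_mul (hw _)]
      rw [← ENNReal.ofReal_sum_of_nonneg]
      · refine ENNReal.ofReal_le_ofReal ?_
        have h3 : ∑ j, w j * ((sepCost (z j) p.1.1 p.1.2 : ℝ) +
            (1 - sep (z j) p.1.1 p.1.2) * K) =
            ∑ j, w j * (sepCost (z j) p.1.1 p.1.2 : ℝ) + (1 - s p) * K := by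
          conv_rhs => rw [← hw1]
          rw [hs, ← Finset.sum_sub_distrib, Finset.sum_mul, ← Finset.sum_add_distrib]
          exact Finset.sum_congr rfl fun j _ => by ring
        rw [h3]
        have h4 := hcs p
        have h5 : s p₀ * (K - c) ≤ s p * (K - c) :=
          mul_le_mul_of_nonneg_right (hp₀ p) (by linarith)
        linarith
      · intro j _
        have : (sep (z j) p.1.1 p.1.2 : ℝ) ≤ 1 := by exact_mod_cast sep_le_one _ _ _
        exact mul_nonneg (hw j) (add_nonneg (Nat.cast_nonneg _)
          (mul_nonneg (by linarith) hK0))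
    have hfin : ENNReal.ofReal r ≤ ENNReal.ofReal (K - s p₀ * (K - c)) :=
      hr.symm.le.trans ((iInf₂_le C hC).trans hCcost)
    have h6 : s p₀ * (r - c) ≤ s p₀ * (K - c) :=
      mul_le_mul_of_nonneg_left (by linarith) (hspos p₀).le
    rcases le_total 0 (K - s p₀ * (K - c)) with h0 | h0
    · have := (ENNReal.ofReal_le_ofReal_iff h0).1 hfin
      linarith
    · rw [ENNReal.ofReal_of_nonpos h0, nonpos_iff_eq_zero, ENNReal.ofReal_eq_zero] at hfin
      exact absurd (hfin.trans c.2) (not_le.2 hcr))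
  refine ⟨PMF.ofFintype (fun p => ENNReal.ofReal (μ p)) ?_, fun D => ?_⟩
  · rw [← ENNReal.ofReal_sum_of_nonneg fun j _ => hμ j, hμ1, ENNReal.ofReal_one]
  · have h := hμa D
    simp only [mul_sub, Finset.sum_sub_distrib, mul_left_comm _ (c : ℝ), ← Finset.mul_sum,
      sub_nonneg] at h
    simp only [mean_eq_sum, PMF.ofFintype_apply, ← ENNReal.ofReal_natCast,
      ← ENNReal.ofReal_mul (hμ _), ← ENNReal.ofReal_coe_nnreal (p := c)]
    rw [← ENNReal.ofReal_sum_of_nonneg fun p _ => mul_nonneg (hμ p) (Nat.cast_nonneg _),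
      ← ENNReal.ofReal_sum_of_nonneg fun p _ => mul_nonneg (hμ p) (Nat.cast_nonneg _),
      ← ENNReal.ofReal_mul (NNReal.coe_nonneg c)]
    exact ENNReal.ofReal_le_ofReal h

/-! ### From the composed function to the outer function -/

section Composition

variable {ι κ β : Type}

/-- The input of the composed function whose block `i` is the first member of the pair `P i` if `z i`
is `0` and the second member if `z i` is `1`. -/
def plant (P : ι → (κ → Bool) × (κ → Bool)) (z : ι → Bool) : ι × κ → Bool := fun k =>
  if z k.1 then (P k.1).2 k.2 else (P k.1).1 k.2

theorem plant_of_eq {P : ι → (κ → Bool) × (κ → Bool)} {z : ι → Bool} {k : ι × κ}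
    (h : (P k.1).1 k.2 = (P k.1).2 k.2) : plant P z k = (P k.1).1 k.2 := by
  simp [plant, h]

/-- The behaviour of a tree on block `i`, when the other blocks are those of `X`. -/
def blockTree [DecidableEq ι] (i : ι) (X : ι × κ → Bool) :
    DecisionTree (ι × κ) Bool β → DecisionTree κ Bool β
  | leaf b => leaf b
  | query k nx => if k.1 = i then query k.2 fun b => blockTree i X (nx b)
      else blockTree i X (nx (X k))

theorem blockTree_congr [DecidableEq ι] {i : ι} {X Y : ι × κ → Bool}
    (h : ∀ k : ι × κ, k.1 ≠ i → X k = Y k) (D : DecisionTree (ι × κ) Bool β) :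
    blockTree i X D = blockTree i Y D := by
  induction D with
  | leaf b => rfl
  | query k nx ih =>
    simp only [blockTree]
    split_ifs with hk
    · simp only [ih]
    · rw [h k hk, ih]

theorem sum_sepCost_blockTree_le [Fintype ι] [DecidableEq ι]
    (P : ι → (κ → Bool) × (κ → Bool)) (z : ι → Bool) (D : DecisionTree (ι × κ) Bool β) :
    ∑ i, sepCost (blockTree i (plant P z) D) (P i).1 (P i).2 ≤ D.cost (plant P z) := by
  induction D with
  | leaf b => simp [blockTree, sepCost]
  | query k nx ih =>
    rw [cost]
    calc _ ≤ ∑ i, (sepCost (blockTree i (plant P z) (nx (plant P z k))) (P i).1 (P i).2 +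
          if i = k.1 then 1 else 0) := by
          refine Finset.sum_le_sum fun i _ => ?_
          simp only [blockTree]
          by_cases hk : k.1 = i
          · subst hk
            simp only [if_true, sepCost]
            split_ifs with h
            · rw [plant_of_eq h]
            · omega
          · rw [if_neg hk]
            omega
      _ ≤ _ := by
          rw [Finset.sum_add_distrib, Finset.sum_ite_eq' Finset.univ k.1]
          simpa using ih (plant P z k)

/-- Run a tree for the composed function on `plant P z`, querying `z` only when needed: the answer
to a query depends on `z` only where the two candidates for the block differ. The bits of `z` known
so far are recorded in `known`. -/
def simulate [DecidableEq ι] (P : ι → (κ → Bool) × (κ → Bool)) :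
    DecisionTree (ι × κ) Bool β → (ι → Option Bool) → DecisionTree ι Bool β
  | leaf b, _ => leaf b
  | query k nx, known =>
    if (P k.1).1 k.2 = (P k.1).2 k.2 then simulate P (nx ((P k.1).1 k.2)) known
    else match known k.1 with
      | some b => simulate P (nx (if b then (P k.1).2 k.2 else (P k.1).1 k.2)) known
      | none => query k.1 fun b =>
          simulate P (nx (if b then (P k.1).2 k.2 else (P k.1).1 k.2))
            (Function.update known k.1 (some b))

theorem output_simulate [DecidableEq ι] (P : ι → (κ → Bool) × (κ → Bool)) (z : ι → Bool)
    (D : DecisionTree (ι × κ) Bool β) (known : ι → Option Bool)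
    (hknown : ∀ i, ∀ b ∈ known i, b = z i) :
    (simulate P D known).output z = D.output (plant P z) := by
  induction D generalizing known with
  | leaf b => rfl
  | query k nx ih =>
    simp only [simulate, output]
    split_ifs with h
    · rw [plant_of_eq h, ih _ _ hknown]
    · cases hk : known k.1 with
      | some b =>
        obtain rfl := hknown k.1 b hk
        exact ih _ _ hknown
      | none =>
        simp only [output]
        refine ih _ _ fun i b hb => ?_
        by_cases hi : i = k.1
        · subst hi
          simpa using hb.symm
        · exact hknown i b (by simpa [hi] using hb)

theorem cost_simulate_le [Fintype ι] [DecidableEq ι] (P : ι → (κ → Bool) × (κ → Bool))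
    (z : ι → Bool) (D : DecisionTree (ι × κ) Bool β) (known : ι → Option Bool)
    (hknown : ∀ i, ∀ b ∈ known i, b = z i) :
    (simulate P D known).cost z ≤
      ∑ i with known i = none, sep (blockTree i (plant P z) D) (P i).1 (P i).2 := by
  induction D generalizing known with
  | leaf b => simp [simulate, cost]
  | query k nx ih =>
    have hstep : ∀ i, k.1 ≠ i ∨ (P k.1).1 k.2 = (P k.1).2 k.2 →
        sep (blockTree i (plant P z) (nx (plant P z k))) (P i).1 (P i).2 =
          sep (blockTree i (plant P z) (query k nx)) (P i).1 (P i).2 := by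
      intro i hi
      simp only [blockTree]
      by_cases hk : k.1 = i
      · subst hk
        have h := hi.resolve_left (by simp)
        simp [sep, h, plant]
      · rw [if_neg hk]
    simp only [simulate]
    split_ifs with h
    · rw [← plant_of_eq (z := z) h]
      refine (ih _ known hknown).trans_eq (Finset.sum_congr rfl fun i _ => hstep i (Or.inr h))
    · cases hk : known k.1 with
      | some b =>
        obtain rfl := hknown k.1 b hk
        refine (ih _ known hknown).trans_eq (Finset.sum_congr rfl fun i hi => hstep i (Or.inl ?_))
        rintro rfl
        simp [hk] at hi
      | none =>
        simp only [cost]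
        have hknown' : ∀ i, ∀ b ∈ Function.update known k.1 (some (z k.1)) i, b = z i := by
          intro i b hb
          by_cases hi : i = k.1
          · subst hi
            simpa using hb.symm
          · exact hknown i b (by simpa [hi] using hb)
        have hfilter : Finset.univ.filter (fun i => known i = none) =
            insert k.1 (Finset.univ.filter fun i =>
              Function.update known k.1 (some (z k.1)) i = none) := by
          ext i
          by_cases hi : i = k.1
          · subst hi
            simp [hk]
          · simp [hi]
        rw [hfilter, Finset.sum_insert (by simp), add_comm]
        have hsep : sep (blockTree k.1 (plant P z) (query k nx)) (P k.1).1 (P k.1).2 = 1 := by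
          simp [blockTree, sep, h]
        rw [hsep]
        refine Nat.add_le_add_left ((ih _ _ hknown').trans_eq
          (Finset.sum_congr rfl fun i hi => hstep i (Or.inl ?_))) 1
        rintro rfl
        simp at hi

/-- Families of independent samples. -/
noncomputable def iidFamily [Fintype ι] [DecidableEq ι] {Q : Type} [Fintype Q] (μ : PMF Q) :
    PMF (ι → Q) :=
  PMF.ofFintype (fun P => ∏ i, μ (P i)) (by
    rw [← Fintype.prod_sum, Finset.prod_eq_one]
    intro i _
    simpa [mean_eq_sum] using mean_const μ 1)

/-- Resampling one member of a family does not change its distribution. -/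
theorem mean_iidFamily_update [Fintype ι] [DecidableEq ι] {Q : Type} [Fintype Q] (μ : PMF Q)
    (i : ι) (φ : (ι → Q) → ℝ≥0∞) :
    mean (iidFamily μ) φ = mean (iidFamily μ) fun P => mean μ fun p => φ (Function.update P i p) := by
  have hmul : ∀ (p : Q) (P : {j // j ≠ i} → Q),
      iidFamily μ ((Equiv.funSplitAt i Q).symm (p, P)) = μ p * ∏ j, μ (P j) := by
    intro p P
    rw [iidFamily, PMF.ofFintype_apply, Fintype.prod_eq_mul_prod_subtype_ne _ i]
    congr 1
    · simp [Equiv.funSplitAt, Equiv.piSplitAt]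
    · refine Finset.prod_congr rfl fun j _ => ?_
      simp [Equiv.funSplitAt, Equiv.piSplitAt, j.2]
  have hup : ∀ (p p' : Q) (P : {j // j ≠ i} → Q),
      Function.update ((Equiv.funSplitAt i Q).symm (p, P)) i p' =
        (Equiv.funSplitAt i Q).symm (p', P) := by
    intro p p' P
    ext j
    by_cases hj : j = i
    · subst hj
      simp [Equiv.funSplitAt, Equiv.piSplitAt]
    · simp [Equiv.funSplitAt, Equiv.piSplitAt, hj]
  rw [mean_eq_sum, mean_eq_sum, ← (Equiv.funSplitAt i Q).symm.sum_comp,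
    ← (Equiv.funSplitAt i Q).symm.sum_comp, Fintype.sum_prod_type_right,
    Fintype.sum_prod_type_right]
  refine Finset.sum_congr rfl fun P _ => ?_
  simp only [hmul, hup, mean_eq_sum]
  have hone : ∑ p, μ p = 1 := by simpa [mean_eq_sum] using mean_const μ 1
  rw [← Finset.sum_mul, ← Finset.sum_mul, hone, one_mul, Finset.mul_sum]
  exact Finset.sum_congr rfl fun p _ => by ring

end Composition

theorem mem_compose_plant {ι κ : Type} {f : (ι → Bool) →. Bool} {g : (κ → Bool) →. Bool}
    (P : ι → OppositeInputs g) (z : ι → Bool) :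
    compose f g (plant (fun i => (P i).1) z) = f z := by
  have hmem : ∀ i, z i ∈ g fun j => plant (fun i => (P i).1) z (i, j) := by
    intro i
    cases hz : z i
    · simpa [plant, hz] using (P i).2.1
    · simpa [plant, hz] using (P i).2.2
  have hdom : ∀ i, (g fun j => plant (fun i => (P i).1) z (i, j)).Dom := fun i =>
    Part.dom_iff_mem.2 ⟨_, hmem i⟩
  rw [compose, Part.assert_pos hdom]
  congr 1
  funext i
  exact Part.get_eq_of_mem (hmem i) _

/-- An algorithm for the composed function, run on random blocks drawn from the hard distribution,
gives an algorithm for the outer function: bit `i` of its input is queried only once the run has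
separated the two candidates for block `i`, which costs the run at least `RS g` queries per unit of
probability. -/
theorem Rbar_mul_RS_le {ι κ : Type} [Fintype ι] [Fintype κ] (ε : ℝ) (f : (ι → Bool) →. Bool)
    (g : (κ → Bool) →. Bool) : Rbar ε f * RS g ≤ Rbar ε (compose f g) := by
  classical
  rw [mul_comm]
  refine ENNReal.mul_le_of_forall_lt fun c' hc' r hr => ?_
  obtain ⟨c, rfl⟩ : ∃ c : ℝ≥0, c' = c :=
    ⟨c'.toNNReal, (ENNReal.coe_toNNReal (ne_top_of_lt hc')).symm⟩
  obtain ⟨μ, hμ⟩ := exists_hard_distribution g hc'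
  have : Fintype (OppositeInputs g) := Fintype.ofFinite _
  refine (mul_le_mul_right hr.le _).trans (le_iInf₂ fun A hA => ?_)
  set blocks : (ι → OppositeInputs g) → ι → (κ → Bool) × (κ → Bool) := fun P i => (P i).1
  let B : RandomizedAlgorithm ι Bool Bool :=
    (iidFamily μ).bind fun P => A.bind fun D => PMF.pure (simulate (blocks P) D fun _ => none)
  have hB : B.Computes f ε := by
    intro z hz
    rw [toOuterMeasure_eq_mean]
    simp only [B, mean_bind, mean_pure]
    refine (mean_const (iidFamily μ) _).symm.le.trans (mean_mono _ fun P => ?_)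
    have hAz := hA (plant (blocks P) z) (by
      change (compose f g _).Dom
      rwa [mem_compose_plant])
    rw [toOuterMeasure_eq_mean] at hAz
    simpa [output_simulate (blocks P) z _ (fun _ => none) (by simp), blocks,
      mem_compose_plant] using hAz
  refine (mul_le_mul_right (iInf₂_le B hB) _).trans ?_
  rw [RandomizedAlgorithm.expectedCost]
  simp only [ENNReal.mul_iSup]
  refine iSup₂_le fun z hz => ?_
  -- the price of separating block `i`, given the tree
  have hblock : ∀ (D : DecisionTree (ι × κ) Bool Bool) (i : ι),
      c * mean (iidFamily μ) (fun P =>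
        (sep (blockTree i (plant (blocks P) z) D) (blocks P i).1 (blocks P i).2 : ℝ≥0∞)) ≤
      mean (iidFamily μ) fun P =>
        (sepCost (blockTree i (plant (blocks P) z) D) (blocks P i).1 (blocks P i).2 : ℝ≥0∞) := by
    intro D i
    rw [mean_iidFamily_update μ i]
    refine le_trans ?_ (mean_iidFamily_update μ i _).symm.le
    rw [← mean_const_mul]
    refine mean_mono _ fun P => ?_
    have htree : ∀ p, blockTree i (plant (blocks (Function.update P i p)) z) D =
        blockTree i (plant (blocks P) z) D := fun p =>
      blockTree_congr (fun k hk => by simp [plant, blocks, hk]) D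
    simpa [htree, blocks] using hμ (blockTree i (plant (blocks P) z) D)
  have hD : ∀ D : DecisionTree (ι × κ) Bool Bool,
      c * mean (iidFamily μ) (fun P =>
        ((simulate (blocks P) D fun _ => none).cost z : ℝ≥0∞)) ≤
      mean (iidFamily μ) fun P => (D.cost (plant (blocks P) z) : ℝ≥0∞) := by
    intro D
    calc _ ≤ c * mean (iidFamily μ) fun P => ∑ i,
          (sep (blockTree i (plant (blocks P) z) D) (blocks P i).1 (blocks P i).2 : ℝ≥0∞) := by
          gcongr
          refine mean_mono _ fun P => ?_
          have := cost_simulate_le (blocks P) z D (fun _ => none) (by simp)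
          simp only [Finset.filter_true] at this
          exact_mod_cast this
      _ ≤ mean (iidFamily μ) fun P => ∑ i,
          (sepCost (blockTree i (plant (blocks P) z) D) (blocks P i).1 (blocks P i).2 : ℝ≥0∞) := by
          rw [mean_sum, mean_sum, Finset.mul_sum]
          exact Finset.sum_le_sum fun i _ => hblock D i
      _ ≤ _ := mean_mono _ fun P => by
          exact_mod_cast sum_sepCost_blockTree_le (blocks P) z D
  calc c * B.expectedQueries z = mean A fun D => c * mean (iidFamily μ) fun P =>
        ((simulate (blocks P) D fun _ => none).cost z : ℝ≥0∞) := by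
        rw [mean_const_mul, mean_comm]
        congr 1
        change mean B _ = _
        simp only [B, mean_bind, mean_pure]
    _ ≤ mean A fun D => mean (iidFamily μ) fun P => (D.cost (plant (blocks P) z) : ℝ≥0∞) :=
        mean_mono A hD
    _ = mean (iidFamily μ) fun P => A.expectedQueries (plant (blocks P) z) := by
        rw [mean_comm]
        rfl
    _ ≤ mean (iidFamily μ) fun _ => A.expectedCost (compose f g) := by
        refine mean_mono _ fun P => ?_
        refine le_iSup₂ (f := fun y (_ : y ∈ (compose f g).Dom) => A.expectedQueries y)
          (plant (blocks P) z) ?_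
        change (compose f g _).Dom
        rwa [mem_compose_plant]
    _ = _ := mean_const _ _

end QueryComplexity

open QueryComplexity
theorem mainTheorem4 {n m : ℕ} (f : (Fin n → Bool) →. Bool) (g : (Fin m → Bool) →. Bool) :
    (∀ ε : ℝ, 0 ≤ ε → Rbar ε (compose f g) ≥ Rbar ε f * RS g) ∧
      R0 (compose f g) ≥ R0 f * RS g ∧
      R (compose f g) ≥ R f * RS g / 10 := by
  refine ⟨fun ε _ => Rbar_mul_RS_le ε f g, Rbar_mul_RS_le 0 f g, ?_⟩
  refine le_trans ?_ ((Rbar_mul_RS_le (1 / 3) f g).trans (Rbar_le_Rerr _ _))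
  refine ENNReal.div_le_of_le_mul ?_
  rw [mul_right_comm, mul_comm _ (10 : ENNReal)]
  gcongr
  exact Rerr_third_le f
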